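/- Let $K$ be a field, let $S=K[x_1,\dots,x_n]$, and let $I\subset S$ be a monomial ideal. Write $G(J)$ for the set of minimal monomial generators of a monomial ideal $J$, and $\operatorname{supp}(u)=\{i : x_i \text{ divides } u\}$ for a monomial $u$. For $k\ge 1$ let $$I^{[k]}=\bigl(f_1\cdots f_k \;:\; f_i\in G(I),\ \operatorname{supp}(f_i)\cap\operatorname{supp}(f_j)=\emptyset \text{ for all } 1\le i<j\le k\bigr)$$ be the $k$-th matching power of $I$, and let $\nu(I)$ be the maximum size of a set of monomials in $I$ with pairwise disjoint supports. A monomial ideal $J$ is called linearly related if it is generated in a single degree and its first syzygy module (the module of $S$-linear relations among the elements of $G(J)$) is generated by linear relations, that is, by relations all of whose coefficients are linear forms (possibly zero). Suppose that $|\operatorname{supp}(w)|=2$ for every $w\in G(I)$, and that $I^{[k]}$ is linearly related for some $k$ with $1\le k<\nu(I)$. If $\operatorname{supp}(u)\ne\operatorname{supp}(v)$ for all $u,v\in G(I^{[k+1]})$ with $u\ne v$, then $I^{[k+1]}$ is linearly related. -/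

import Mathlib

namespace MatchingPowers

open MvPolynomial

/-- `I` is a monomial ideal: it is generated by a set of monomials.
Monomials are represented by their exponent vectors `a : σ →₀ ℕ`. -/
def IsMonomialIdeal {σ K : Type*} [Field K] (I : Ideal (MvPolynomial σ K)) : Prop :=
  ∃ A : Set (σ →₀ ℕ), I = Ideal.span ((fun a => monomial a (1 : K)) '' A)

/-- The set `G(I)` of minimal monomial generators of a monomial ideal `I`, as a set of exponent
vectors: the monomials of `I` that are minimal with respect to divisibility.
(Divisibility of monomials is the componentwise order on exponent vectors, and the support of
a monomial is the support of its exponent vector.) -/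
def minGens {σ K : Type*} [Field K] (I : Ideal (MvPolynomial σ K)) : Set (σ →₀ ℕ) :=
  {a | Minimal (fun b => monomial b (1 : K) ∈ I) a}

/-- The `k`-th matching power `I^{[k]}` of a monomial ideal `I`: the ideal generated by the products
of `k` minimal monomial generators of `I` with pairwise disjoint supports. -/
noncomputable def matchingPower {σ K : Type*} [Field K] (I : Ideal (MvPolynomial σ K)) (k : ℕ) :
    Ideal (MvPolynomial σ K) :=
  Ideal.span {p | ∃ f : Fin k → (σ →₀ ℕ), (∀ i, f i ∈ minGens I) ∧
    (∀ i j, i ≠ j → Disjoint (f i).support (f j).support) ∧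
    p = ∏ i, monomial (f i) (1 : K)}

/-- The monomial grade `ν(I)`: the maximal size of a set of monomials in `I` whose supports are
pairwise disjoint, as an extended natural number. -/
noncomputable def monomialGrade {σ K : Type*} [Field K] (I : Ideal (MvPolynomial σ K)) : ℕ∞ :=
  ⨆ s ∈ {s : Finset (σ →₀ ℕ) | (∀ a ∈ s, monomial a (1 : K) ∈ I) ∧
    ∀ a ∈ s, ∀ b ∈ s, a ≠ b → Disjoint a.support b.support}, (s.card : ℕ∞)

/-- The first syzygy module of a monomial ideal `I`: the relations `∑ r_u u = 0`, with polynomial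
coefficients `r_u`, between the minimal monomial generators `u` of `I`, that is, the kernel of the
canonical map from the free module on `G(I)` onto `I`. -/
noncomputable def syzygies {σ K : Type*} [Field K] (I : Ideal (MvPolynomial σ K)) :
    Submodule (MvPolynomial σ K) (minGens I →₀ MvPolynomial σ K) :=
  LinearMap.ker (Finsupp.linearCombination (MvPolynomial σ K)
    (fun u : minGens I => monomial (u : σ →₀ ℕ) (1 : K)))

/-- A monomial ideal `I` is linearly related: it is generated in a single degree `d`, and its first
syzygy module is generated by linear relations, that is, by those relations `∑ r_u u = 0`
all of whose coefficients `r_u` are linear forms (possibly zero). -/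
def IsLinearlyRelated {σ K : Type*} [Field K] (I : Ideal (MvPolynomial σ K)) : Prop :=
  (∃ d : ℕ, ∀ u ∈ minGens I, Finsupp.degree u = d) ∧
  Submodule.span (MvPolynomial σ K) {r | r ∈ syzygies I ∧ ∀ u, (r u).IsHomogeneous 1} = syzygies I

end MatchingPowers

/-! Syzygies of a monomial ideal are spanned by binomial relations between pairs of generators, so
it suffices that every pair `u`, `v` in `G(I^{[k+1]})` is `Linked`. If `u ≠ v`, their supports
differ but have equal size, so some variable `a` divides `u` and not `v`. Write `u = f b` with `a`
in the support of `f`; as `f` has only one other variable, it meets at most one factor `g` of `v = g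
c`. Then `w = f c` is a generator dividing `lcm(u, v)`, so `u`–`w`–`v` is a chain whose neighbours
share a factor: `f`, then (as `k ≥ 1`) a factor of `c`. Generators sharing a factor are linked by
`linked_of_common_factor`: setting the variables of `f` to zero and multiplying by `f` carries
linear relations of `I^{[k]}` to linear relations of `I^{[k+1]}`. -/

namespace MatchingPowers

open MvPolynomial

/-! ### Binomial relations, and transport of linear syzygies -/

section Syzygies

variable {σ K : Type*} [Field K]

/-- If a submodule contains all the binomial relations between the minimal generators of a monomial
ideal, then it contains all of its syzygies. -/
theorem syzygies_le_of_binomial_mem {J : Ideal (MvPolynomial σ K)}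
    (L : Submodule (MvPolynomial σ K) (minGens J →₀ MvPolynomial σ K))
    (h : ∀ (u v : minGens J) (m : σ →₀ ℕ), (u : σ →₀ ℕ) ≤ m → (v : σ →₀ ℕ) ≤ m →
      Finsupp.single u (monomial (m - (u : σ →₀ ℕ)) (1 : K)) -
        Finsupp.single v (monomial (m - (v : σ →₀ ℕ)) (1 : K)) ∈ L) :
    syzygies J ≤ L := by
  classical
  -- By `h` this class does not depend on the chosen generator; the value 0 is only for monomials
  -- outside `J`.
  let τ : (σ →₀ ℕ) → ((minGens J →₀ MvPolynomial σ K) ⧸ L) := fun m =>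
    if hm : ∃ u : minGens J, (u : σ →₀ ℕ) ≤ m then
      L.mkQ (Finsupp.single hm.choose (monomial (m - (hm.choose : σ →₀ ℕ)) (1 : K))) else 0
  have hτ : ∀ (u : minGens J) (a : σ →₀ ℕ),
      τ (a + u) = L.mkQ (Finsupp.single u (monomial a (1 : K))) := by
    intro u a
    have hu : (u : σ →₀ ℕ) ≤ a + u := le_add_self
    have hm : ∃ v : minGens J, (v : σ →₀ ℕ) ≤ a + u := ⟨u, hu⟩
    have key := h hm.choose u _ hm.choose_spec hu
    rw [add_tsub_cancel_right] at key
    simp only [τ, dif_pos hm]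
    exact (Submodule.Quotient.eq L).2 key
  let ψ : MvPolynomial σ K →ₗ[K] ((minGens J →₀ MvPolynomial σ K) ⧸ L) :=
    (basisMonomials σ K).constr K τ
  have hψ : ∀ m, ψ (monomial m 1) = τ m := fun m => by
    have := (basisMonomials σ K).constr_basis K τ m
    simpa [ψ] using this
  have hcomp : ∀ r : minGens J →₀ MvPolynomial σ K,
      ψ (Finsupp.linearCombination (MvPolynomial σ K)
        (fun u : minGens J => monomial (u : σ →₀ ℕ) (1 : K)) r) = L.mkQ r := by
    intro r
    induction r using Finsupp.induction_linear with
    | zero => simp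
    | add r s hr hs => rw [map_add, map_add, map_add, hr, hs]
    | single u p =>
      rw [Finsupp.linearCombination_single]
      induction p using MvPolynomial.induction_on' with
      | add p q hp hq => rw [add_smul, map_add, hp, hq, Finsupp.single_add, map_add]
      | monomial a c =>
        have h1 : (monomial a c : MvPolynomial σ K) • (monomial (u : σ →₀ ℕ) (1 : K)) =
            c • monomial (a + (u : σ →₀ ℕ)) (1 : K) := by
          rw [smul_eq_mul, monomial_mul, smul_monomial, smul_eq_mul]
        have h2 : Finsupp.single u (monomial a c : MvPolynomial σ K) =
            c • Finsupp.single u (monomial a (1 : K)) := by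
          rw [Finsupp.smul_single, smul_monomial, smul_eq_mul, mul_one]
        rw [h1, map_smul, hψ, hτ, h2]
        rfl
  intro r hr
  have := hcomp r
  rw [LinearMap.mem_ker.1 hr, map_zero] at this
  exact (Submodule.Quotient.mk_eq_zero L).1 this.symm

theorem binomial_mem_syzygies {J : Ideal (MvPolynomial σ K)} (u v : minGens J) (m : σ →₀ ℕ)
    (hu : (u : σ →₀ ℕ) ≤ m) (hv : (v : σ →₀ ℕ) ≤ m) :
    Finsupp.single u (monomial (m - (u : σ →₀ ℕ)) (1 : K)) -
      Finsupp.single v (monomial (m - (v : σ →₀ ℕ)) (1 : K)) ∈ syzygies J := by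
  rw [syzygies, LinearMap.mem_ker, map_sub, Finsupp.linearCombination_single,
    Finsupp.linearCombination_single, smul_eq_mul, smul_eq_mul, monomial_mul, monomial_mul,
    tsub_add_cancel_of_le hu, tsub_add_cancel_of_le hv, sub_self]

/-- The submodule generated by the linear relations. -/
noncomputable def linearSyzygies (J : Ideal (MvPolynomial σ K)) :
    Submodule (MvPolynomial σ K) (minGens J →₀ MvPolynomial σ K) :=
  Submodule.span (MvPolynomial σ K) {r | r ∈ syzygies J ∧ ∀ u, (r u).IsHomogeneous 1}

/-- The relation between `u` and `v` in every common multiple is a combination of linear ones. -/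
def Linked (J : Ideal (MvPolynomial σ K)) (u v : minGens J) : Prop :=
  ∀ m : σ →₀ ℕ, (u : σ →₀ ℕ) ≤ m → (v : σ →₀ ℕ) ≤ m →
    Finsupp.single u (monomial (m - (u : σ →₀ ℕ)) (1 : K)) -
      Finsupp.single v (monomial (m - (v : σ →₀ ℕ)) (1 : K)) ∈ linearSyzygies J

/-- Since `w` divides the lcm, every common multiple of `u` and `v` is one of `w` too, and the two
binomials telescope. -/
theorem Linked.trans {J : Ideal (MvPolynomial σ K)} {u v w : minGens J} (huw : Linked J u w)
    (hwv : Linked J w v) (hw : (w : σ →₀ ℕ) ≤ (u : σ →₀ ℕ) ⊔ v) : Linked J u v := by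
  intro m hu hv
  have hwm : (w : σ →₀ ℕ) ≤ m := hw.trans (sup_le hu hv)
  simpa using add_mem (huw m hu hwm) (hwv m hwm hv)

theorem linked_of_binomial_mem {J : Ideal (MvPolynomial σ K)} {u v : minGens J} {b : σ →₀ ℕ}
    (hb : b ≤ (u : σ →₀ ℕ) ⊔ v) (hu : (u : σ →₀ ℕ) ≤ b) (hv : (v : σ →₀ ℕ) ≤ b)
    (h : Finsupp.single u (monomial (b - (u : σ →₀ ℕ)) (1 : K)) -
      Finsupp.single v (monomial (b - (v : σ →₀ ℕ)) (1 : K)) ∈ linearSyzygies J) : Linked J u v := by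
  intro m hum hvm
  have hbm : b ≤ m := hb.trans (sup_le hum hvm)
  have key := (linearSyzygies J).smul_mem (monomial (m - b) (1 : K)) h
  rwa [smul_sub, Finsupp.smul_single, Finsupp.smul_single, smul_eq_mul, smul_eq_mul,
    monomial_mul, monomial_mul, one_mul, tsub_add_tsub_cancel hbm hu,
    tsub_add_tsub_cancel hbm hv] at key

theorem isLinearlyRelated_of_linked {J : Ideal (MvPolynomial σ K)}
    (hd : ∃ d : ℕ, ∀ u ∈ minGens J, Finsupp.degree u = d) (h : ∀ u v, Linked J u v) :
    IsLinearlyRelated J :=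
  ⟨hd, le_antisymm (Submodule.span_le.2 fun _ hr => hr.1)
    (syzygies_le_of_binomial_mem (linearSyzygies J) h)⟩

open Classical in
/-- The substitution `x_i ↦ 0` for `i` in the support of `f`. -/
noncomputable def killSupport (f : σ →₀ ℕ) : MvPolynomial σ K →ₐ[K] MvPolynomial σ K :=
  aeval fun i => if i ∈ f.support then 0 else X i

theorem killSupport_monomial_of_disjoint {f w : σ →₀ ℕ} (h : Disjoint f.support w.support) :
    killSupport f (monomial w (1 : K)) = monomial w 1 := by
  classical
  rw [killSupport, aeval_monomial, map_one, one_mul, monomial_eq, map_one, one_mul]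
  refine Finsupp.prod_congr fun i hi => ?_
  rw [if_neg (Finset.disjoint_right.1 h hi)]

theorem killSupport_monomial_of_not_disjoint {f w : σ →₀ ℕ}
    (h : ¬ Disjoint f.support w.support) : killSupport f (monomial w (1 : K)) = 0 := by
  classical
  obtain ⟨i, hif, hiw⟩ := Finset.not_disjoint_iff.1 h
  rw [killSupport, aeval_monomial, map_one, one_mul]
  refine Finset.prod_eq_zero hiw ?_
  beta_reduce
  rw [if_pos hif, zero_pow (Finsupp.mem_support_iff.1 hiw)]

theorem IsHomogeneous.killSupport {p : MvPolynomial σ K} (f : σ →₀ ℕ) {d : ℕ}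
    (hp : p.IsHomogeneous d) : (killSupport f p).IsHomogeneous d := by
  classical
  have := hp.aeval (fun i => if i ∈ f.support then (0 : MvPolynomial σ K) else X i) (n := 1)
    (fun i => by
      split_ifs
      · exact isHomogeneous_zero _ _ _
      · exact isHomogeneous_X _ _)
  rwa [one_mul] at this

open Classical in
/-- The map of free modules induced by multiplication by a monomial `f`, after the substitution
`x_i ↦ 0` for `i` in the support of `f`. -/
noncomputable def transport {J J' : Ideal (MvPolynomial σ K)} (f : σ →₀ ℕ)
    (hf : ∀ w ∈ minGens J, Disjoint f.support w.support → f + w ∈ minGens J') :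
    (minGens J →₀ MvPolynomial σ K) →+ (minGens J' →₀ MvPolynomial σ K) :=
  (Finsupp.linearCombination (MvPolynomial σ K) fun w : minGens J =>
    if h : Disjoint f.support (w : σ →₀ ℕ).support then
      Finsupp.single (⟨f + w, hf w w.2 h⟩ : minGens J') (1 : MvPolynomial σ K)
    else 0).toAddMonoidHom.comp
    (Finsupp.mapRange.addMonoidHom (killSupport f : MvPolynomial σ K →ₐ[K] _).toAddMonoidHom)

variable {J J' : Ideal (MvPolynomial σ K)} {f : σ →₀ ℕ}
  {hf : ∀ w ∈ minGens J, Disjoint f.support w.support → f + w ∈ minGens J'}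

theorem transport_single_of_disjoint (w : minGens J) (p : MvPolynomial σ K)
    (h : Disjoint f.support (w : σ →₀ ℕ).support) :
    transport f hf (Finsupp.single w p) =
      Finsupp.single ⟨f + w, hf w w.2 h⟩ (killSupport f p) := by
  simp [transport, h]

theorem transport_single_of_not_disjoint (w : minGens J) (p : MvPolynomial σ K)
    (h : ¬ Disjoint f.support (w : σ →₀ ℕ).support) :
    transport f hf (Finsupp.single w p) = 0 := by
  simp [transport, h]

/-- Semilinearity over `killSupport f`, not linearity, is what holds; it still carries spans into
spans. -/
theorem transport_smul (s : MvPolynomial σ K) (r : minGens J →₀ MvPolynomial σ K) :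
    transport f hf (s • r) = killSupport f s • transport f hf r := by
  induction r using Finsupp.induction_linear with
  | zero => simp
  | add r t hr ht => rw [smul_add, map_add, map_add, hr, ht, smul_add]
  | single w p =>
    rw [Finsupp.smul_single]
    by_cases h : Disjoint f.support (w : σ →₀ ℕ).support
    · rw [transport_single_of_disjoint w _ h, transport_single_of_disjoint w _ h,
        Finsupp.smul_single, smul_eq_mul, map_mul, smul_eq_mul]
    · rw [transport_single_of_not_disjoint w _ h, transport_single_of_not_disjoint w _ h, smul_zero]

theorem linearCombination_transport (r : minGens J →₀ MvPolynomial σ K) :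
    Finsupp.linearCombination (MvPolynomial σ K)
        (fun u : minGens J' => monomial (u : σ →₀ ℕ) (1 : K)) (transport f hf r) =
      monomial f 1 * killSupport f (Finsupp.linearCombination (MvPolynomial σ K)
        (fun u : minGens J => monomial (u : σ →₀ ℕ) (1 : K)) r) := by
  induction r using Finsupp.induction_linear with
  | zero => simp
  | add r t hr ht => simp only [map_add, hr, ht, mul_add]
  | single w p =>
    by_cases h : Disjoint f.support (w : σ →₀ ℕ).support
    · rw [transport_single_of_disjoint w _ h, Finsupp.linearCombination_single,
        Finsupp.linearCombination_single, smul_eq_mul, smul_eq_mul, map_mul,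
        killSupport_monomial_of_disjoint h, mul_left_comm, monomial_mul, one_mul]
    · rw [transport_single_of_not_disjoint w _ h, Finsupp.linearCombination_single, smul_eq_mul,
        map_mul, killSupport_monomial_of_not_disjoint h, mul_zero, mul_zero, map_zero]

theorem isHomogeneous_transport {d : ℕ} (r : minGens J →₀ MvPolynomial σ K)
    (hr : ∀ u, (r u).IsHomogeneous d) (v : minGens J') :
    (transport f hf r v).IsHomogeneous d := by
  classical
  have h : transport f hf r = ∑ w ∈ r.support, transport f hf (Finsupp.single w (r w)) := by
    conv_lhs => rw [← Finsupp.sum_single r, Finsupp.sum, map_sum]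
  rw [h, Finsupp.finsetSum_apply]
  refine IsHomogeneous.sum _ _ _ fun w _ => ?_
  by_cases hw : Disjoint f.support (w : σ →₀ ℕ).support
  · rw [transport_single_of_disjoint w _ hw, Finsupp.single_apply]
    split_ifs
    · exact IsHomogeneous.killSupport f (hr w)
    · exact isHomogeneous_zero _ _ _
  · rw [transport_single_of_not_disjoint w _ hw]
    exact isHomogeneous_zero _ _ _

theorem transport_mem_linearSyzygies {r : minGens J →₀ MvPolynomial σ K}
    (hr : r ∈ linearSyzygies J) : transport f hf r ∈ linearSyzygies J' := by
  induction hr using Submodule.span_induction with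
  | mem r hr =>
    refine Submodule.subset_span ⟨?_, isHomogeneous_transport r hr.2⟩
    rw [syzygies, LinearMap.mem_ker, linearCombination_transport, LinearMap.mem_ker.1 hr.1,
      map_zero, mul_zero]
  | zero => rw [map_zero]; exact zero_mem _
  | add r s _ _ hr hs => rw [map_add]; exact add_mem hr hs
  | smul s r _ hr => rw [transport_smul]; exact Submodule.smul_mem _ _ hr

/-- Two minimal generators `f u` and `f v` of `J'` are linked if `J` is linearly related, `u` and
`v` are minimal generators of `J`, and multiplication by `f` maps generators of `J` with support
disjoint from that of `f` to generators of `J'`. -/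
theorem linked_of_common_factor (hJ : IsLinearlyRelated J)
    (hf : ∀ w ∈ minGens J, Disjoint f.support w.support → f + w ∈ minGens J')
    {u v : σ →₀ ℕ} (hu : u ∈ minGens J) (hv : v ∈ minGens J)
    (hfu : Disjoint f.support u.support) (hfv : Disjoint f.support v.support) :
    Linked J' ⟨f + u, hf u hu hfu⟩ ⟨f + v, hf v hv hfv⟩ := by
  classical
  have hsup : Disjoint f.support (u ⊔ v).support := by
    rw [Finsupp.support_sup, Finset.disjoint_union_right]
    exact ⟨hfu, hfv⟩
  have hmem : Finsupp.single (⟨u, hu⟩ : minGens J) (monomial (u ⊔ v - u) (1 : K)) -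
      Finsupp.single (⟨v, hv⟩ : minGens J) (monomial (u ⊔ v - v) (1 : K)) ∈ linearSyzygies J := by
    rw [linearSyzygies, hJ.2]
    exact binomial_mem_syzygies ⟨u, hu⟩ ⟨v, hv⟩ _ le_sup_left le_sup_right
  have key := transport_mem_linearSyzygies (hf := hf) hmem
  -- The cofactors divide `lcm(u, v)`, which avoids the variables of `f`, so the substitution fixes
  -- them.
  have hdisj : ∀ w : σ →₀ ℕ, Disjoint f.support (u ⊔ v - w).support := fun w =>
    hsup.mono_right (Finsupp.support_mono tsub_le_self)
  rw [map_sub, transport_single_of_disjoint _ _ hfu, transport_single_of_disjoint _ _ hfv,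
    killSupport_monomial_of_disjoint (hdisj u), killSupport_monomial_of_disjoint (hdisj v)] at key
  refine linked_of_binomial_mem (b := f + u ⊔ v) ?_ (add_le_add_right le_sup_left f)
    (add_le_add_right le_sup_right f) ?_
  · intro i
    simp only [Finsupp.add_apply, Finsupp.sup_apply]
    omega
  · simpa only [add_tsub_add_eq_tsub_left] using key

end Syzygies

/-! ### Products of generators with disjoint supports, and an exchange property -/

section Matchings

variable {σ : Type*}

/-- `b` is the exponent of a product of `k` members of `E` with pairwise disjoint supports. -/
def IsMatchingSum (E : Set (σ →₀ ℕ)) (k : ℕ) (b : σ →₀ ℕ) : Prop :=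
  ∃ f : Fin k → (σ →₀ ℕ), (∀ i, f i ∈ E) ∧
    (∀ i j, i ≠ j → Disjoint (f i).support (f j).support) ∧ b = ∑ i, f i

variable {E : Set (σ →₀ ℕ)} {k : ℕ}

theorem disjoint_support_sum {ι : Type*} (s : Finset ι) (g : ι → (σ →₀ ℕ)) {a : σ →₀ ℕ}
    (h : ∀ i ∈ s, Disjoint a.support (g i).support) :
    Disjoint a.support (∑ i ∈ s, g i).support := by
  classical
  rw [Finset.disjoint_left]
  intro x hx hxs
  obtain ⟨i, hi, hxi⟩ := Finset.mem_biUnion.1 (Finsupp.support_finsetSum hxs)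
  exact Finset.disjoint_left.1 (h i hi) hx hxi

theorem IsMatchingSum.add {b f : σ →₀ ℕ} (hb : IsMatchingSum E k b) (hf : f ∈ E)
    (h : Disjoint f.support b.support) : IsMatchingSum E (k + 1) (f + b) := by
  obtain ⟨g, hg, hdis, rfl⟩ := hb
  have hfg : ∀ i, Disjoint f.support (g i).support := fun i =>
    h.mono_right (Finsupp.support_mono
      (Finset.single_le_sum (f := g) (fun _ _ => zero_le) (Finset.mem_univ i)))
  refine ⟨Fin.cons f g, ?_, ?_, by rw [Fin.sum_cons]⟩
  · intro i
    cases i using Fin.cases with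
    | zero => exact hf
    | succ i => exact hg i
  · intro i j hij
    cases i using Fin.cases with
    | zero =>
      cases j using Fin.cases with
      | zero => exact absurd rfl hij
      | succ j => exact hfg j
    | succ i =>
      cases j using Fin.cases with
      | zero => exact (hfg i).symm
      | succ j => exact hdis i j fun e => hij (by rw [e])

theorem isMatchingSum_removeNth {f : Fin (k + 1) → (σ →₀ ℕ)} (hE : ∀ i, f i ∈ E)
    (hdis : ∀ i j, i ≠ j → Disjoint (f i).support (f j).support) (i : Fin (k + 1)) :
    IsMatchingSum E k (∑ j, f (i.succAbove j)) ∧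
      Disjoint (f i).support (∑ j, f (i.succAbove j)).support :=
  ⟨⟨fun j => f (i.succAbove j), fun _ => hE _,
      fun _ _ h => hdis _ _ fun e => h (Fin.succAbove_right_injective e), rfl⟩,
    disjoint_support_sum _ _ fun j _ => hdis _ _ (Fin.succAbove_ne i j).symm⟩

theorem IsMatchingSum.exists_factor {b : σ →₀ ℕ} (hb : IsMatchingSum E (k + 1) b) {a : σ}
    (ha : a ∈ b.support) : ∃ f ∈ E, ∃ c, a ∈ f.support ∧ IsMatchingSum E k c ∧
      Disjoint f.support c.support ∧ b = f + c := by
  classical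
  obtain ⟨f, hE, hdis, rfl⟩ := hb
  obtain ⟨i, -, hi⟩ := Finset.mem_biUnion.1 (Finsupp.support_finsetSum ha)
  obtain ⟨h1, h2⟩ := isMatchingSum_removeNth hE hdis i
  exact ⟨f i, hE i, _, hi, h1, h2, Fin.sum_univ_succAbove f i⟩

theorem IsMatchingSum.exists_factor' {b : σ →₀ ℕ} (hb : IsMatchingSum E (k + 1) b) :
    ∃ f ∈ E, ∃ c, IsMatchingSum E k c ∧ Disjoint f.support c.support ∧ b = f + c := by
  obtain ⟨f, hE, hdis, rfl⟩ := hb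
  obtain ⟨h1, h2⟩ := isMatchingSum_removeNth hE hdis 0
  exact ⟨f 0, hE 0, _, h1, h2, Fin.sum_univ_succAbove f 0⟩

theorem card_support_add_of_disjoint {f g : σ →₀ ℕ} (h : Disjoint f.support g.support) :
    (f + g).support.card = f.support.card + g.support.card := by
  classical
  rw [Finsupp.support_add_eq h, Finset.card_union_of_disjoint h]

theorem IsMatchingSum.card_support (hE : ∀ w ∈ E, w.support.card = 2) :
    ∀ {k : ℕ} {b : σ →₀ ℕ}, IsMatchingSum E k b → b.support.card = 2 * k
  | 0, b, ⟨f, _, _, hb⟩ => by simp [hb]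
  | k + 1, b, hb => by
    obtain ⟨f, hf, c, hc, hdis, rfl⟩ := hb.exists_factor'
    rw [card_support_add_of_disjoint hdis, hE f hf, hc.card_support hE]
    ring

/-- A two-element set which is not contained in the support of a matching product meets the supports
of all but one of the factors trivially. -/
theorem IsMatchingSum.exists_exchange (hE : ∀ w ∈ E, w.support.card = 2) {b f : σ →₀ ℕ}
    (hb : IsMatchingSum E (k + 1) b) (hf : f ∈ E) {a : σ} (haf : a ∈ f.support)
    (hab : a ∉ b.support) : ∃ g ∈ E, ∃ c, IsMatchingSum E k c ∧ Disjoint g.support c.support ∧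
      Disjoint f.support c.support ∧ b = g + c := by
  classical
  by_cases h : Disjoint f.support b.support
  · obtain ⟨g, hg, c, hc, hgc, rfl⟩ := hb.exists_factor'
    exact ⟨g, hg, c, hc, hgc, h.mono_right (Finsupp.support_mono le_add_self), rfl⟩
  -- Here `p` is the only variable of `f` other than `a`, so the factor `g` containing `p` is the
  -- only one met by `f`.
  · obtain ⟨p, hpf, hpb⟩ := Finset.not_disjoint_iff.1 h
    obtain ⟨g, hg, c, hpg, hc, hgc, rfl⟩ := hb.exists_factor hpb
    refine ⟨g, hg, c, hc, hgc, ?_, rfl⟩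
    have hap : a ≠ p := fun e => hab (e ▸ hpb)
    have hfs : f.support = {a, p} := by
      refine (Finset.eq_of_subset_of_card_le ?_ ?_).symm
      · intro x hx
        rcases Finset.mem_insert.1 hx with rfl | hx
        · exact haf
        · rwa [Finset.mem_singleton.1 hx]
      · rw [hE f hf, Finset.card_pair hap]
    rw [hfs, Finset.disjoint_insert_left, Finset.disjoint_singleton_left]
    exact ⟨fun hac => hab (Finsupp.support_mono le_add_self hac), Finset.disjoint_left.1 hgc hpg⟩

end Matchings

/-! ### Generators of matching powers, their degrees, and links between them -/

section MatchingPower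

variable {σ K : Type*} [Field K] {I : Ideal (MvPolynomial σ K)} {k : ℕ}

theorem monomial_mem_matchingPower {b : σ →₀ ℕ} :
    monomial b (1 : K) ∈ matchingPower I k ↔ ∃ a, IsMatchingSum (minGens I) k a ∧ a ≤ b := by
  classical
  have h : matchingPower I k =
      Ideal.span ((fun a => monomial a (1 : K)) '' {a | IsMatchingSum (minGens I) k a}) := by
    unfold matchingPower
    congr 1
    ext p
    constructor
    · rintro ⟨f, h1, h2, rfl⟩
      exact ⟨_, ⟨f, h1, h2, rfl⟩, by simp [monomial_sum_one]⟩
    · rintro ⟨_, ⟨f, h1, h2, rfl⟩, rfl⟩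
      exact ⟨f, h1, h2, by simp [monomial_sum_one]⟩
  rw [h, mem_ideal_span_monomial_image]
  simp [support_monomial]

theorem isMatchingSum_of_mem_minGens {b : σ →₀ ℕ} (hb : b ∈ minGens (matchingPower I k)) :
    IsMatchingSum (minGens I) k b := by
  obtain ⟨a, ha, hab⟩ := monomial_mem_matchingPower.1 hb.1
  have hba : b ≤ a := hb.2 (monomial_mem_matchingPower.2 ⟨a, ha, le_rfl⟩) hab
  rwa [le_antisymm hba hab]

/-- A matching product properly dividing `b` would, multiplied by `f`, properly divide `f b`. -/
theorem mem_minGens_of_add_mem_minGens {f b : σ →₀ ℕ} (hf : f ∈ minGens I)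
    (hb : IsMatchingSum (minGens I) k b) (hdis : Disjoint f.support b.support)
    (h : f + b ∈ minGens (matchingPower I (k + 1))) : b ∈ minGens (matchingPower I k) := by
  refine ⟨monomial_mem_matchingPower.2 ⟨b, hb, le_rfl⟩, fun c hc hcb => ?_⟩
  obtain ⟨a, ha, hac⟩ := monomial_mem_matchingPower.1 hc
  have hab : a ≤ b := hac.trans hcb
  have hfa := ha.add hf (hdis.mono_right (Finsupp.support_mono hab))
  have := h.2 (monomial_mem_matchingPower.2 ⟨_, hfa, le_rfl⟩) (add_le_add_right hab f)
  exact (le_of_add_le_add_left this).trans hac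

/-- Removing any one of the `k + 1` factors leaves a generator of degree `d`; sum over the factors.
-/
theorem degree_eq_of_mem_minGens {d : ℕ}
    (hd : ∀ u ∈ minGens (matchingPower I k), Finsupp.degree u = d)
    {u : σ →₀ ℕ} (hu : u ∈ minGens (matchingPower I (k + 1))) :
    k * Finsupp.degree u = (k + 1) * d := by
  obtain ⟨f, hE, hdis, rfl⟩ := isMatchingSum_of_mem_minGens hu
  have key : ∀ i, (∑ j, f j).degree = (f i).degree + d := by
    intro i
    obtain ⟨h1, h2⟩ := isMatchingSum_removeNth hE hdis i
    rw [Fin.sum_univ_succAbove f i] at hu ⊢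
    rw [map_add, hd _ (mem_minGens_of_add_mem_minGens (hE i) h1 h2 hu)]
  have hsum : ∑ _i : Fin (k + 1), (∑ j, f j).degree = ∑ i, ((f i).degree + d) :=
    Finset.sum_congr rfl fun i _ => key i
  rw [Finset.sum_add_distrib, ← map_sum Finsupp.degree f] at hsum
  simp only [Finset.sum_const, Finset.card_univ, Fintype.card_fin, smul_eq_mul] at hsum
  linarith

theorem mem_minGens_of_degree_eq {D : ℕ}
    (hD : ∀ u ∈ minGens (matchingPower I k), Finsupp.degree u = D)
    {b : σ →₀ ℕ} (hb : IsMatchingSum (minGens I) k b) (hdeg : Finsupp.degree b = D) :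
    b ∈ minGens (matchingPower I k) := by
  refine ⟨monomial_mem_matchingPower.2 ⟨b, hb, le_rfl⟩, fun c hc hcb => ?_⟩
  obtain ⟨m, hmc, hm⟩ := exists_minimal_le_of_wellFoundedLT
    (fun a : σ →₀ ℕ => monomial a (1 : K) ∈ matchingPower I k) c hc
  have h1 := hD m hm
  obtain ⟨e, rfl⟩ := exists_add_of_le (hmc.trans hcb)
  rw [map_add] at hdeg
  have he : e = 0 := (Finsupp.degree_eq_zero_iff e).1 (by omega)
  rw [he, add_zero]
  exact hmc

theorem linked_of_common_generator {d D : ℕ}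
    (hlin : IsLinearlyRelated (matchingPower I k))
    (hd : ∀ u ∈ minGens (matchingPower I k), Finsupp.degree u = d)
    (hD : ∀ u ∈ minGens (matchingPower I (k + 1)), Finsupp.degree u = D)
    {f b c : σ →₀ ℕ} (hf : f ∈ minGens I)
    (hb : IsMatchingSum (minGens I) k b) (hc : IsMatchingSum (minGens I) k c)
    (hfb : Disjoint f.support b.support) (hfc : Disjoint f.support c.support)
    (hb' : f + b ∈ minGens (matchingPower I (k + 1)))
    (hc' : f + c ∈ minGens (matchingPower I (k + 1))) :
    Linked (matchingPower I (k + 1)) ⟨f + b, hb'⟩ ⟨f + c, hc'⟩ := by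
  have hbm := mem_minGens_of_add_mem_minGens hf hb hfb hb'
  have hcm := mem_minGens_of_add_mem_minGens hf hc hfc hc'
  have hdeg := hD _ hb'
  rw [map_add, hd _ hbm] at hdeg
  have hmul : ∀ w ∈ minGens (matchingPower I k), Disjoint f.support w.support →
      f + w ∈ minGens (matchingPower I (k + 1)) := fun w hw hfw =>
    mem_minGens_of_degree_eq hD ((isMatchingSum_of_mem_minGens hw).add hf hfw)
      (by rw [map_add, hd _ hw, hdeg])
  exact linked_of_common_factor hlin hmul hbm hcm hfb hfc

theorem linked_of_support_ne {d D : ℕ} (hk : 1 ≤ k) (hE : ∀ w ∈ minGens I, w.support.card = 2)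
    (hlin : IsLinearlyRelated (matchingPower I k))
    (hd : ∀ u ∈ minGens (matchingPower I k), Finsupp.degree u = d)
    (hD : ∀ u ∈ minGens (matchingPower I (k + 1)), Finsupp.degree u = D)
    (u v : minGens (matchingPower I (k + 1)))
    (huv : (u : σ →₀ ℕ).support ≠ (v : σ →₀ ℕ).support) :
    Linked (matchingPower I (k + 1)) u v := by
  obtain ⟨u, hu⟩ := u
  obtain ⟨v, hv⟩ := v
  have hus := isMatchingSum_of_mem_minGens hu
  have hvs := isMatchingSum_of_mem_minGens hv
  have hnot : ¬ u.support ⊆ v.support := fun h =>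
    huv (Finset.eq_of_subset_of_card_le h (by rw [hus.card_support hE, hvs.card_support hE]))
  obtain ⟨a, hau, hav⟩ := Finset.not_subset.1 hnot
  obtain ⟨f, hf, b, haf, hb, hfb, rfl⟩ := hus.exists_factor hau
  obtain ⟨g, hg, c, hc, hgc, hfc, rfl⟩ := hvs.exists_exchange hE hf haf hav
  have hw : f + c ∈ minGens (matchingPower I (k + 1)) := by
    refine mem_minGens_of_degree_eq hD (hc.add hf hfc) ?_
    rw [← hD _ hu, map_add, map_add, hd _ (mem_minGens_of_add_mem_minGens hf hb hfb hu),
      hd _ (mem_minGens_of_add_mem_minGens hg hc hgc hv)]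
  have h1 : Linked (matchingPower I (k + 1)) ⟨f + b, hu⟩ ⟨f + c, hw⟩ :=
    linked_of_common_generator hlin hd hD hf hb hc hfb hfc hu hw
  have h2 : Linked (matchingPower I (k + 1)) ⟨f + c, hw⟩ ⟨g + c, hv⟩ := by
    classical
    -- This is where `k ≥ 1` enters: `c` has a factor `e`, common to `f c` and `g c`.
    obtain ⟨k, rfl⟩ := Nat.exists_eq_add_of_le' hk
    obtain ⟨e, he, c, hc', hec, rfl⟩ := hc.exists_factor'
    have hsupp : (e + c).support = e.support ∪ c.support := Finsupp.support_add_eq hec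
    rw [hsupp, Finset.disjoint_union_right] at hgc hfc
    have key : ∀ x ∈ minGens I, Disjoint x.support e.support → Disjoint x.support c.support →
        IsMatchingSum (minGens I) (k + 1) (x + c) ∧ Disjoint e.support (x + c).support := by
      intro x hx hxe hxc
      refine ⟨hc'.add hx hxc, ?_⟩
      rw [Finsupp.support_add_eq hxc, Finset.disjoint_union_right]
      exact ⟨hxe.symm, hec⟩
    obtain ⟨hf1, hf2⟩ := key f hf hfc.1 hfc.2
    obtain ⟨hg1, hg2⟩ := key g hg hgc.1 hgc.2
    simp only [add_left_comm f e c, add_left_comm g e c] at hw hv ⊢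
    exact linked_of_common_generator hlin hd hD he hf1 hg1 hf2 hg2 hw hv
  refine h1.trans h2 ?_
  intro i
  -- By disjointness `f c` is the lcm of `f` and `c`, which divide `u` and `v` respectively.
  have hdis : f i = 0 ∨ c i = 0 := by
    by_contra! hne
    exact Finset.disjoint_left.1 hfc (Finsupp.mem_support_iff.2 hne.1)
      (Finsupp.mem_support_iff.2 hne.2)
  simp only [Finsupp.add_apply, Finsupp.sup_apply]
  omega

end MatchingPower

end MatchingPowers

theorem mainTheorem8 {K : Type*} [Field K] (n : ℕ) (I : Ideal (MvPolynomial (Fin n) K))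
    (hI : MatchingPowers.IsMonomialIdeal I)
    (hsupp : ∀ w ∈ MatchingPowers.minGens I, w.support.card = 2)
    (k : ℕ) (hk : 1 ≤ k) (hkν : (k : ℕ∞) < MatchingPowers.monomialGrade I)
    (hlin : MatchingPowers.IsLinearlyRelated (MatchingPowers.matchingPower I k))
    (hdist : ∀ u ∈ MatchingPowers.minGens (MatchingPowers.matchingPower I (k + 1)),
      ∀ v ∈ MatchingPowers.minGens (MatchingPowers.matchingPower I (k + 1)),
        u ≠ v → u.support ≠ v.support) :
    MatchingPowers.IsLinearlyRelated (MatchingPowers.matchingPower I (k + 1)) := by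
  obtain ⟨d, hd⟩ := hlin.1
  have hD : ∀ u ∈ MatchingPowers.minGens (MatchingPowers.matchingPower I (k + 1)),
      -- The quotient is exact whenever a generator exists, so no generator has to be exhibited.
      Finsupp.degree u = (k + 1) * d / k := fun u hu =>
    (Nat.div_eq_of_eq_mul_right hk (MatchingPowers.degree_eq_of_mem_minGens hd hu).symm).symm
  refine MatchingPowers.isLinearlyRelated_of_linked ⟨_, hD⟩ fun u v => ?_
  by_cases h : u = v
  · subst h
    intro m _ _
    rw [sub_self]
    exact zero_mem _
  · exact MatchingPowers.linked_of_support_ne hk hsupp hlin hd hD u v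
      (hdist u u.2 v v.2 fun e => h (Subtype.ext e))
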